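/- All rings are associative and unital, and modules are unital. For a right $R$-module $M$ let $E(M)$ denote an injective hull of $M$. A ring $R$ is called a right $H$-ring if $\mathrm{Hom}_R(E(S),E(T))=0$ for all non-isomorphic simple right $R$-modules $S,T$; a right max-ring if every nonzero right $R$-module has a maximal submodule; and right strongly dual Kasch if every simple right $R$-module $S$ is a homomorphic image of its injective hull $E(S)$. A commutative ring is called perfect if every $R$-module has a projective cover. Proposition. If $R$ is a right $H$-ring and a right max-ring, then $R$ is right strongly dual Kasch. Moreover, every commutative perfect ring is strongly dual Kasch. -/

import Mathlib

universe u

/-- `ι : M → E` exhibits `E` as an injective hull `E(M)` of the `A`-module `M`: `ι` is injective,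
`E` is injective, and the image of `ι` is essential in `E` (it meets every nonzero submodule of `E`
nontrivially). -/
structure IsInjectiveHull {A : Type u} [Ring A] {M E : Type u} [AddCommGroup M] [Module A M]
    [AddCommGroup E] [Module A E] (ι : M →ₗ[A] E) : Prop where
  injective : Function.Injective ι
  injectiveModule : Module.Injective A E
  essential : ∀ N : Submodule A E, N ≠ ⊥ → N ⊓ LinearMap.range ι ≠ ⊥

/-- Every module has an injective hull, so that quantifying over the injective hulls of a module
(which are all isomorphic) is never vacuous. -/
theorem exists_isInjectiveHull (A : Type u) [Ring A] (M : Type u) [AddCommGroup M] [Module A M] :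
    ∃ (E : Type u) (_ : AddCommGroup E) (_ : Module A E) (ι : M →ₗ[A] E), IsInjectiveHull ι := by
  -- an injective module `Q` containing `M`
  obtain ⟨Q, _, _, j, hj, hQ⟩ : ∃ (Q : Type u) (_ : AddCommGroup Q) (_ : Module A Q)
      (j : M →ₗ[A] Q), Function.Injective j ∧ Module.Injective A Q := by
    obtain ⟨⟨P, hP, f, hf⟩⟩ :=
      CategoryTheory.EnoughInjectives.presentation (ModuleCat.of A M)
    exact ⟨P, inferInstance, inferInstance, f.hom, (ModuleCat.mono_iff_injective f).1 hf,
      Module.injective_module_of_injective_object A P⟩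
  set S := LinearMap.range j with hS
  -- a maximal essential extension of `S` inside `Q`
  obtain ⟨E, hSE, hE⟩ := zorn_le_nonempty₀
      {E : Submodule A Q | S ≤ E ∧ ∀ N ≤ E, N ⊓ S = ⊥ → N = ⊥} (by
    intro c hc hchain y hy
    refine ⟨sSup c, ⟨(hc hy).1.trans (le_sSup hy), fun N hN hNS => ?_⟩, fun z hz => le_sSup hz⟩
    rw [Submodule.eq_bot_iff]
    intro x hx
    obtain ⟨E, hEc, hxE⟩ := (Submodule.mem_sSup_of_directed ⟨y, hy⟩ hchain.directedOn).1 (hN hx)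
    have h := (hc hEc).2 (N ⊓ E) inf_le_right
      (eq_bot_iff.2 (hNS ▸ inf_le_inf_right S inf_le_left))
    exact (Submodule.eq_bot_iff _).1 h x ⟨hx, hxE⟩)
    S ⟨le_rfl, fun N hN h => by rwa [inf_eq_left.2 hN] at h⟩
  -- a complement `K` of `E`
  obtain ⟨K, -, hK⟩ := zorn_le_nonempty₀ {K : Submodule A Q | K ⊓ E = ⊥} (by
    intro c hc hchain y hy
    refine ⟨sSup c, ?_, fun z hz => le_sSup hz⟩
    change sSup c ⊓ E = ⊥
    rw [Submodule.eq_bot_iff]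
    rintro x ⟨hx, hxE⟩
    obtain ⟨K, hKc, hxK⟩ := (Submodule.mem_sSup_of_directed ⟨y, hy⟩ hchain.directedOn).1 hx
    exact (Submodule.eq_bot_iff _).1 (hc hKc) x ⟨hxK, hxE⟩)
    ⊥ (show ⊥ ⊓ E = ⊥ from bot_inf_eq E)
  have hKE : K ⊓ E = ⊥ := hK.prop
  have hinj : Function.Injective (K.mkQ ∘ₗ E.subtype) := by
    rw [← LinearMap.ker_eq_bot, Submodule.eq_bot_iff]
    rintro ⟨x, hx⟩ h
    have hxK : x ∈ K := by simpa using h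
    exact Subtype.ext ((Submodule.eq_bot_iff _).1 hKE x ⟨hxK, hx⟩)
  obtain ⟨g, hg⟩ := hQ.out (K.mkQ ∘ₗ E.subtype) hinj E.subtype
  have hg' : ∀ x ∈ E, g (K.mkQ x) = x := fun x hx => hg ⟨x, hx⟩
  -- every submodule above `K` that meets `E` trivially is `K`
  have hmax : ∀ L : Submodule A Q, K ≤ L → L ⊓ E = ⊥ → L ≤ K := fun L h1 h2 => hK.le_of_ge h2 h1
  have hrange : LinearMap.range g ≤ E := by
    refine hE.le_of_ge ⟨fun x hx => ⟨K.mkQ x, hg' x (hSE hx)⟩, fun N hN hNS => ?_⟩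
      (fun x hx => ⟨K.mkQ x, hg' x hx⟩)
    have hNE : N ⊓ E = ⊥ := hE.prop.2 _ inf_le_right
      (eq_bot_iff.2 (hNS ▸ inf_le_inf_right S inf_le_left))
    have hker : ∀ x, g (K.mkQ x) = 0 → x ∈ K := by
      intro x hx
      refine hmax (LinearMap.ker (g ∘ₗ K.mkQ)) (fun y hy => ?_) ?_ hx
      · have : K.mkQ y = 0 := by simpa using hy
        simp only [LinearMap.mem_ker, LinearMap.comp_apply, this, map_zero]
      · rw [Submodule.eq_bot_iff]
        rintro y ⟨hy, hyE⟩
        have h0 : g (K.mkQ y) = 0 := hy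
        rwa [hg' y hyE] at h0
    rw [Submodule.eq_bot_iff]
    intro x hx
    obtain ⟨y, rfl⟩ := hN hx
    obtain ⟨z, rfl⟩ := K.mkQ_surjective y
    have hz : z ∈ K := by
      refine hmax (N.comap (g ∘ₗ K.mkQ)) (fun y hy => ?_) ?_ hx
      · have : K.mkQ y = 0 := by simpa using hy
        simp only [Submodule.mem_comap, LinearMap.comp_apply, this, map_zero, zero_mem]
      · rw [Submodule.eq_bot_iff]
        rintro y ⟨hy, hyE⟩
        have h0 : g (K.mkQ y) ∈ N := hy
        rw [hg' y hyE] at h0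
        exact (Submodule.eq_bot_iff _).1 hNE y ⟨h0, hyE⟩
    have : K.mkQ z = 0 := by simpa using hz
    rw [this, map_zero]
  -- `E` is a retract of `Q`
  have hret : Module.Injective A E := ⟨fun X Y _ _ _ _ f hf k => by
    obtain ⟨h, hh⟩ := hQ.out f hf (E.subtype ∘ₗ k)
    refine ⟨(g.codRestrict E fun x => hrange ⟨x, rfl⟩) ∘ₗ K.mkQ ∘ₗ h, fun x => Subtype.ext ?_⟩
    have h1 : g (K.mkQ (h (f x))) = k x := by rw [hh x]; exact hg' _ (k x).2
    exact h1⟩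
  refine ⟨E, inferInstance, inferInstance, j.codRestrict E fun x => hSE ⟨x, rfl⟩,
    fun x y hxy => hj (congrArg Subtype.val hxy), hret, fun N hN h => hN ?_⟩
  have h1 := hE.prop.2 (N.map E.subtype) (Submodule.map_subtype_le E N) (by
    rw [Submodule.eq_bot_iff]
    rintro _ ⟨⟨x, hx, rfl⟩, ⟨y, hy⟩⟩
    have := (Submodule.eq_bot_iff _).1 h x ⟨hx, ⟨y, Subtype.ext hy⟩⟩
    rw [this, map_zero])
  rw [Submodule.eq_bot_iff] at h1 ⊢
  exact fun x hx => Subtype.ext (h1 x ⟨x, hx, rfl⟩)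

/-- `π : P → M` is a projective cover of `M`: `P` is projective, `π` is surjective, and its kernel
is superfluous (small) in `P`. -/
structure IsProjectiveCover {A : Type u} [Ring A] {P M : Type u} [AddCommGroup P] [Module A P]
    [AddCommGroup M] [Module A M] (π : P →ₗ[A] M) : Prop where
  projective : Module.Projective A P
  surjective : Function.Surjective π
  superfluous : ∀ N : Submodule A P, LinearMap.ker π ⊔ N = ⊤ → N = ⊤

/-! Right `R`-modules are modules over the opposite ring `Rᵐᵒᵖ`. -/

/-- `R` is a right `H`-ring: `Hom(E(S), E(T)) = 0` for all non-isomorphic simple right `R`-modules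
`S` and `T`. -/
def IsRightHRing (R : Type u) [Ring R] : Prop :=
  ∀ (S T ES ET : Type u) [AddCommGroup S] [AddCommGroup T] [AddCommGroup ES] [AddCommGroup ET]
    [Module Rᵐᵒᵖ S] [Module Rᵐᵒᵖ T] [Module Rᵐᵒᵖ ES] [Module Rᵐᵒᵖ ET]
    (ιS : S →ₗ[Rᵐᵒᵖ] ES) (ιT : T →ₗ[Rᵐᵒᵖ] ET),
    IsSimpleModule Rᵐᵒᵖ S → IsSimpleModule Rᵐᵒᵖ T → ¬ Nonempty (S ≃ₗ[Rᵐᵒᵖ] T) →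
    IsInjectiveHull ιS → IsInjectiveHull ιT → ∀ f : ES →ₗ[Rᵐᵒᵖ] ET, f = 0

/-- `R` is a right max-ring: every nonzero right `R`-module has a maximal (proper) submodule. -/
def IsRightMaxRing (R : Type u) [Ring R] : Prop :=
  ∀ (M : Type u) [AddCommGroup M] [Module Rᵐᵒᵖ M], Nontrivial M →
    ∃ N : Submodule Rᵐᵒᵖ M, IsCoatom N

/-- `R` is right strongly dual Kasch: every simple right `R`-module `S` is a homomorphic image of
its injective hull `E(S)`. -/
def IsRightStronglyDualKasch (R : Type u) [Ring R] : Prop :=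
  ∀ (S E : Type u) [AddCommGroup S] [AddCommGroup E] [Module Rᵐᵒᵖ S] [Module Rᵐᵒᵖ E]
    (ι : S →ₗ[Rᵐᵒᵖ] E), IsSimpleModule Rᵐᵒᵖ S → IsInjectiveHull ι →
    ∃ f : E →ₗ[Rᵐᵒᵖ] S, Function.Surjective f

/-- `R` is right perfect: every right `R`-module has a projective cover. (For commutative `R` this
is the same as left perfect, and one says that `R` is perfect.) -/
def IsRightPerfect (R : Type u) [Ring R] : Prop :=
  ∀ (M : Type u) [AddCommGroup M] [Module Rᵐᵒᵖ M],
    ∃ (P : Type u) (_ : AddCommGroup P) (_ : Module Rᵐᵒᵖ P) (π : P →ₗ[Rᵐᵒᵖ] M),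
      IsProjectiveCover π

/-! Over a max-ring the nonzero module E(S) has a simple quotient T, so it suffices that T ≅ S. For
an H-ring, E(S) → T → E(T) is nonzero, which forces this. Commutative rings need no H-hypothesis
here: an element killing T but not S would act bijectively on E(S), hence surjectively on T. Perfect
gives max by passing to a projective cover: nonzero projectives have maximal submodules by Nakayama
applied to coordinates, and a small kernel lies in every maximal submodule. -/

/-- Over a right H-ring, a simple quotient of the injective hull of a simple module `S` is
isomorphic to `S`. -/
theorem IsRightHRing.nonempty_equiv_quotient {R : Type u} [Ring R] (hR : IsRightHRing R)
    {S E : Type u} [AddCommGroup S] [AddCommGroup E] [Module Rᵐᵒᵖ S] [Module Rᵐᵒᵖ E]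
    {ι : S →ₗ[Rᵐᵒᵖ] E} [IsSimpleModule Rᵐᵒᵖ S] (hι : IsInjectiveHull ι)
    {N : Submodule Rᵐᵒᵖ E} (hN : IsCoatom N) : Nonempty (S ≃ₗ[Rᵐᵒᵖ] (E ⧸ N)) := by
  by_contra hne
  have hT : IsSimpleModule Rᵐᵒᵖ (E ⧸ N) := isSimpleModule_iff_isCoatom.2 hN
  obtain ⟨F, _, _, κ, hκ⟩ := exists_isInjectiveHull Rᵐᵒᵖ (E ⧸ N)
  have h0 := hR S (E ⧸ N) E F ι κ inferInstance hT hne hι hκ (κ ∘ₗ N.mkQ)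
  refine hN.1 (eq_top_iff.2 fun x _ => (Submodule.Quotient.mk_eq_zero N).1 (hκ.injective ?_))
  rw [map_zero]
  exact LinearMap.congr_fun h0 x

/-- The injective hull of a simple module is nonzero. -/
theorem IsInjectiveHull.nontrivial {A : Type u} [Ring A] {S E : Type u} [AddCommGroup S]
    [Module A S] [AddCommGroup E] [Module A E] {ι : S →ₗ[A] E} (hι : IsInjectiveHull ι)
    [Nontrivial S] : Nontrivial E :=
  hι.injective.nontrivial

/-- Over a commutative ring, a simple quotient of the injective hull of a simple module `S` is
isomorphic to `S`. -/
theorem IsInjectiveHull.nonempty_equiv_quotient {A : Type u} [CommRing A] {S E : Type u}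
    [AddCommGroup S] [Module A S] [AddCommGroup E] [Module A E] {ι : S →ₗ[A] E}
    [IsSimpleModule A S] (hι : IsInjectiveHull ι) {N : Submodule A E} (hN : IsCoatom N) :
    Nonempty (S ≃ₗ[A] (E ⧸ N)) := by
  have hT : IsSimpleModule A (E ⧸ N) := isSimpleModule_iff_isCoatom.2 hN
  obtain ⟨m, hm, ⟨e⟩⟩ := isSimpleModule_iff_quot_maximal.1 (inferInstance : IsSimpleModule A S)
  obtain ⟨n, hn, ⟨e'⟩⟩ := isSimpleModule_iff_quot_maximal.1 hT
  suffices h : n ≤ m by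
    obtain rfl := hn.eq_of_le hm.ne_top h
    exact ⟨e.trans e'.symm⟩
  -- Suppose `r` annihilates `E ⧸ N` but not `S`. As `m` is prime, `r` acts injectively on `S`.
  intro r hr
  by_contra hrm
  have hS : ∀ s : S, r • s = 0 → s = 0 := by
    intro s hs
    obtain ⟨a, ha⟩ := Ideal.Quotient.mk_surjective (e s)
    have h1 : r • e s = 0 := by rw [← map_smul, hs, map_zero]
    rw [← ha] at h1
    have h2 : r * a ∈ m := Ideal.Quotient.eq_zero_iff_mem.1 h1
    have h3 : a ∈ m := (hm.isPrime.mem_or_mem h2).resolve_left hrm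
    rw [Ideal.Quotient.eq_zero_iff_mem.2 h3] at ha
    exact e.map_eq_zero_iff.1 ha.symm
  -- The kernel of `r` on `E` meets the image of `S` trivially, so it vanishes by essentiality.
  have hinj : Function.Injective (LinearMap.lsmul A E r) := by
    rw [← LinearMap.ker_eq_bot]
    by_contra hne
    refine hι.essential _ hne ?_
    rw [Submodule.eq_bot_iff]
    rintro _ ⟨hx, s, rfl⟩
    have hx' : r • ι s = 0 := hx
    rw [← map_smul] at hx'
    rw [hS s (hι.injective (hx'.trans (map_zero ι).symm)), map_zero]
  -- Injectivity of `E` gives `g` with `g (r • x) = x`. By linearity `x = r • g x`, so `E = rE ≤ N`.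
  obtain ⟨g, hg⟩ := hι.injectiveModule.out (LinearMap.lsmul A E r) hinj LinearMap.id
  refine hN.1 (eq_top_iff.2 fun x _ => (Submodule.Quotient.mk_eq_zero N).1 ?_)
  have hx : x = r • g x := by
    have := hg x
    simp only [LinearMap.lsmul_apply, map_smul, LinearMap.id_apply] at this
    exact this.symm
  apply e'.injective
  rw [hx, Submodule.Quotient.mk_smul, map_smul, map_zero]
  obtain ⟨a, ha⟩ := Ideal.Quotient.mk_surjective (e' (Submodule.Quotient.mk (g x)))
  rw [← ha]
  exact Ideal.Quotient.eq_zero_iff_mem.2 (n.mul_mem_right a hr)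

/-- A nonzero projective module over a commutative ring has a maximal submodule. -/
theorem Module.Projective.exists_isCoatom {A P : Type*} [CommRing A] [AddCommGroup P] [Module A P]
    [Module.Projective A P] [Nontrivial P] : ∃ N : Submodule A P, IsCoatom N := by
  by_contra! hno
  -- If `f p ∉ m`, then `P → A ⧸ m` is onto a simple module and its kernel is maximal.
  have hJ : ∀ (f : P →ₗ[A] A) (p : P), f p ∈ Ideal.jacobson (⊥ : Ideal A) := by
    intro f p
    refine Ideal.mem_sInf.2 ?_
    rintro m ⟨-, hm⟩
    by_contra hp
    have hs : IsSimpleModule A (A ⧸ m) := isSimpleModule_iff_isCoatom.2 hm.out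
    have hne : m.mkQ ∘ₗ f ≠ 0 := fun h =>
      hp ((Submodule.Quotient.mk_eq_zero m).1 (LinearMap.congr_fun h p))
    exact hno _ (LinearMap.isCoatom_ker_of_surjective (LinearMap.surjective_of_ne_zero hne))
  obtain ⟨s, hs⟩ := Module.projective_def.1 (inferInstance : Module.Projective A P)
  obtain ⟨x, hx⟩ := exists_ne (0 : P)
  -- The finitely many coordinates of `x` under the section `s` generate an ideal `I` with `I ≤ J
  -- I`, `J` the Jacobson radical; Nakayama gives `I = 0`.
  have hI : Ideal.span (s x '' (s x).support) = ⊥ := by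
    refine Submodule.eq_bot_of_le_smul_of_le_jacobson_bot (Ideal.jacobson ⊥) _
      (Submodule.fg_span ((s x).support.finite_toSet.image _)) ?_ le_rfl
    rw [Ideal.span_le]
    rintro _ ⟨q, -, rfl⟩
    -- Apply the `q`-th coordinate of `s` to `x = ∑ (s x p) • p`; each `s p q` lies in `J` by `hJ`.
    have hq : s x q = (s x).sum fun p c => s p q * c := by
      conv_lhs => rw [← hs x, Finsupp.linearCombination_apply, Finsupp.sum]
      simp [Finsupp.sum, Finsupp.finsetSum_apply, mul_comm]
    rw [SetLike.mem_coe, hq]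
    refine Submodule.sum_mem _ fun p hp => ?_
    exact Submodule.smul_mem_smul (hJ (Finsupp.lapply q ∘ₗ s) p)
      (Ideal.subset_span ⟨p, hp, rfl⟩)
  apply hx
  rw [← hs x]
  have h0 : s x = 0 := by
    ext q
    by_contra hq
    exact hq ((Submodule.eq_bot_iff _).1 hI _
      (Ideal.subset_span ⟨q, Finsupp.mem_support_iff.2 hq, rfl⟩))
  rw [h0, map_zero]

/-- A module that has a projective cover with a maximal submodule has a maximal submodule. -/
theorem IsProjectiveCover.exists_isCoatom {A : Type u} [Ring A] {P M : Type u} [AddCommGroup P]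
    [Module A P] [AddCommGroup M] [Module A M] {π : P →ₗ[A] M} (hπ : IsProjectiveCover π)
    {N : Submodule A P} (hN : IsCoatom N) : ∃ N' : Submodule A M, IsCoatom N' := by
  have hker : LinearMap.ker π ≤ N := by
    by_contra h
    exact hN.1 (hπ.superfluous N (hN.2 _ (by rwa [right_lt_sup])))
  exact ⟨N.map π, Submodule.isCoatom_map_of_ker_le hπ.surjective hker hN⟩

/-- A commutative perfect ring is a max-ring. -/
theorem IsRightPerfect.isRightMaxRing {R : Type u} [CommRing R] (hR : IsRightPerfect R) :
    IsRightMaxRing R := by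
  intro M _ _ _
  obtain ⟨P, _, _, π, hπ⟩ := hR M
  have := hπ.projective
  have := hπ.surjective.nontrivial
  obtain ⟨N, hN⟩ := Module.Projective.exists_isCoatom (A := Rᵐᵒᵖ) (P := P)
  exact hπ.exists_isCoatom hN

/-- Over a right max-ring, a module all of whose simple quotients are isomorphic to `S` maps onto
`S`, provided that it is nonzero. -/
theorem IsRightMaxRing.exists_surjective {R : Type u} [Ring R] (hR : IsRightMaxRing R)
    {S E : Type u} [AddCommGroup S] [AddCommGroup E] [Module Rᵐᵒᵖ S] [Module Rᵐᵒᵖ E]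
    [Nontrivial E]
    (h : ∀ N : Submodule Rᵐᵒᵖ E, IsCoatom N → Nonempty (S ≃ₗ[Rᵐᵒᵖ] (E ⧸ N))) :
    ∃ f : E →ₗ[Rᵐᵒᵖ] S, Function.Surjective f := by
  obtain ⟨N, hN⟩ := hR E inferInstance
  obtain ⟨e⟩ := h N hN
  exact ⟨e.symm.toLinearMap ∘ₗ N.mkQ, e.symm.surjective.comp N.mkQ_surjective⟩

theorem mainTheorem8 :
    (∀ (R : Type u) [Ring R], IsRightHRing R → IsRightMaxRing R → IsRightStronglyDualKasch R) ∧
    (∀ (R : Type u) [CommRing R], IsRightPerfect R → IsRightStronglyDualKasch R) := by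
  refine ⟨fun R _ hH hmax S E _ _ _ _ ι hS hι => ?_, fun R _ hR S E _ _ _ _ ι hS hι => ?_⟩
  · have := IsSimpleModule.nontrivial Rᵐᵒᵖ S
    have := hι.nontrivial
    exact hmax.exists_surjective fun N hN => hH.nonempty_equiv_quotient hι hN
  · have := IsSimpleModule.nontrivial Rᵐᵒᵖ S
    have := hι.nontrivial
    -- `Rᵐᵒᵖ` is itself commutative, so the commutative lemma applies over it directly.
    exact hR.isRightMaxRing.exists_surjective fun N hN =>
      IsInjectiveHull.nonempty_equiv_quotient (A := Rᵐᵒᵖ) hι hN
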